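/- Let $\mathcal A$ be a complex unital Banach algebra. An element $u\in\mathcal A$ is quasinilpotent if its spectral radius is $0$. An element $a\in\mathcal A$ is generalized Drazin invertible, written $a\in\mathcal A^d$, if there is $a^d\in\mathcal A$ (necessarily unique) such that $a^d a a^d=a^d$, $aa^d=a^da$ and $a-a^2a^d$ is quasinilpotent; put $a^\pi=1-aa^d$. Let $a,b\in\mathcal A^d$ satisfy $a^\pi ba=a^\pi aba^\pi$, and suppose that at least one of the elements $$a^\pi ba^\pi,\quad a^\pi b,\quad ba^\pi,\quad aa^dbaa^d,\quad aa^db,\quad baa^d$$ is generalized Drazin invertible. Put $e=(a+b)aa^d$. Then $$a+b\in\mathcal A^d\iff aa^d(a+b)\in\mathcal A^d\iff e\in\mathcal A^d\iff aa^d(a+b)aa^d\in\mathcal A^d .$$ In this case, all the series below converge (unconditionally, in norm) and $$\begin{aligned} (a+b)^d={}&e^d+\sum_{n=0}^\infty a^\pi(-a)^n(b^d)^{n+1}-\sum_{n=0}^\infty e^dba^\pi(-a)^n(b^d)^{n+1}\\ &+\sum_{n=0}^\infty e^\pi e^n aa^db\Bigl(\sum_{k=0}^\infty a^\pi(-a)^k(b^d)^{k+1}\Bigr)^{n+2}\\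 &+\sum_{n=0}^\infty\Bigl[(e^d)^{n+2}ba^\pi(a+b)^n-\sum_{k=0}^\infty(e^d)^{n+2}ba^\pi(a+b)^{n+1}a^\pi(-a)^k(b^d)^{k+1}\Bigr]. \end{aligned}$$ -/

import Mathlib

/-- An element of a complex Banach algebra is quasinilpotent if its spectral radius is zero. -/
def IsQuasinilpotent {A : Type*} [NormedRing A] [NormedAlgebra ℂ A] (a : A) : Prop :=
  spectralRadius ℂ a = 0

/-- `x` is a generalized (Koliha) Drazin inverse of `a`:
`x a x = x`, `a x = x a`, and `a - a² x` is quasinilpotent. -/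
structure IsGDrazinInverse {A : Type*} [NormedRing A] [NormedAlgebra ℂ A] (a x : A) : Prop where
  mul_mul_self : x * a * x = x
  comm : a * x = x * a
  quasinilpotent : IsQuasinilpotent (a - a ^ 2 * x)

/-- `a` is generalized Drazin invertible, that is, `a` belongs to `A^d`. -/
def GDInvertible {A : Type*} [NormedRing A] [NormedAlgebra ℂ A] (a : A) : Prop :=
  ∃ x : A, IsGDrazinInverse a x

open Classical in
/-- The generalized Drazin inverse `a^d` of `a` (with value `0` if `a` has none); it is the
unique one, see `IsGDrazinInverse.eq_gdInv`. -/
noncomputable def gdInv {A : Type*} [NormedRing A] [NormedAlgebra ℂ A] (a : A) : A :=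
  if h : ∃ x : A, IsGDrazinInverse a x then h.choose else 0

postfix:max "ᵈ" => gdInv

/-- The spectral idempotent `a^π = 1 - a a^d`. -/
noncomputable def spectralIdem {A : Type*} [NormedRing A] [NormedAlgebra ℂ A] (a : A) : A :=
  1 - a * aᵈ

postfix:max "ᵖⁱ" => spectralIdem

theorem GDInvertible.isGDrazinInverse {A : Type*} [NormedRing A] [NormedAlgebra ℂ A] {a : A}
    (h : GDInvertible a) : IsGDrazinInverse a aᵈ := by
  have h' : ∃ x : A, IsGDrazinInverse a x := h
  unfold gdInv
  rw [dif_pos h']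
  exact h'.choose_spec

/-- For a quasinilpotent `u` and any `x`, `‖u ^ n‖ * ‖x‖ ^ n` tends to zero. -/
theorem IsQuasinilpotent.tendsto_mul_pow {A : Type*} [NormedRing A] [NormedAlgebra ℂ A]
    [CompleteSpace A] {u : A} (hu : IsQuasinilpotent u) (x : A) :
    Filter.Tendsto (fun n : ℕ => ‖u ^ n‖ * ‖x‖ ^ n) Filter.atTop (nhds 0) := by
  have hG := spectrum.pow_nnnorm_pow_one_div_tendsto_nhds_spectralRadius u
  rw [show spectralRadius ℂ u = 0 from hu] at hG
  have hc : (0 : ENNReal) < ((2 * (‖x‖₊ + 1))⁻¹ : NNReal) := by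
    rw [ENNReal.coe_pos]; positivity
  have hev := (hG.eventually_lt_const hc).and (Filter.eventually_gt_atTop 0)
  refine squeeze_zero' (Filter.Eventually.of_forall fun n => by positivity) ?_
    (tendsto_pow_atTop_nhds_zero_of_lt_one (r := (1 / 2 : ℝ)) (by norm_num) (by norm_num))
  filter_upwards [hev] with n hn
  obtain ⟨h1, h2⟩ := hn
  have hn0 : (n : ℝ) ≠ 0 := by exact_mod_cast h2.ne'
  have h3 : (‖u ^ n‖₊ : ENNReal) ≤ (((2 * (‖x‖₊ + 1))⁻¹ ^ n : NNReal) : ENNReal) := by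
    have h4 := ENNReal.rpow_le_rpow h1.le (Nat.cast_nonneg (α := ℝ) n)
    rw [← ENNReal.rpow_mul, one_div, inv_mul_cancel₀ hn0, ENNReal.rpow_one,
      ENNReal.rpow_natCast] at h4
    exact_mod_cast h4
  have h5 : ‖u ^ n‖ ≤ (2 * (‖x‖ + 1))⁻¹ ^ n := by exact_mod_cast h3
  calc ‖u ^ n‖ * ‖x‖ ^ n ≤ (2 * (‖x‖ + 1))⁻¹ ^ n * ‖x‖ ^ n := by gcongr
    _ = ((2 * (‖x‖ + 1))⁻¹ * ‖x‖) ^ n := (mul_pow _ _ _).symm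
    _ ≤ (1 / 2) ^ n := by
      have h6 : (2 * (‖x‖ + 1))⁻¹ * ‖x‖ ≤ 1 / 2 := by
        have := norm_nonneg x
        rw [inv_mul_le_iff₀ (by positivity)]
        linarith
      gcongr

theorem IsGDrazinInverse.mul_eq {A : Type*} [NormedRing A] [NormedAlgebra ℂ A] [CompleteSpace A]
    {a x y : A} (hx : IsGDrazinInverse a x) (hy : IsGDrazinInverse a y) :
    a * x = a * y * (a * x) ∧ a * x = a * x * (a * y) := by
  have hcx : Commute a x := hx.comm
  have hcy : Commute a y := hy.comm
  have hq : IsIdempotentElem (1 - a * y) := by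
    apply IsIdempotentElem.one_sub
    change a * y * (a * y) = a * y
    rw [mul_assoc, ← mul_assoc y, hy.mul_mul_self]
  have hp : IsIdempotentElem (a * x) := by
    change a * x * (a * x) = a * x
    rw [mul_assoc, ← mul_assoc x, hx.mul_mul_self]
  have hcq : Commute a (1 - a * y) :=
    (Commute.one_right a).sub_right ((Commute.refl a).mul_right hcy)
  have hu : a - a ^ 2 * y = a * (1 - a * y) := by noncomm_ring
  have hlim := (hy.quasinilpotent).tendsto_mul_pow x
  rw [hu] at hlim
  have hpow : ∀ n : ℕ, (a * (1 - a * y)) ^ (n + 1) = a ^ (n + 1) * (1 - a * y) := fun n => by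
    rw [hcq.mul_pow, hq.pow_succ_eq]
  have hpn : ∀ n : ℕ, a ^ (n + 1) * x ^ (n + 1) = a * x := fun n => by
    rw [← hcx.mul_pow, hp.pow_succ_eq]
  have key1 : (1 - a * y) * (a * x) = 0 := by
    rw [← norm_le_zero_iff]
    refine ge_of_tendsto (hlim.comp (Filter.tendsto_add_atTop_nat 1)) ?_
    refine Filter.Eventually.of_forall fun n => ?_
    have : (1 - a * y) * (a * x) = (a * (1 - a * y)) ^ (n + 1) * x ^ (n + 1) := by
      rw [hpow, (hcq.pow_left (n + 1)).eq, mul_assoc, hpn]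
    rw [this]
    exact (norm_mul_le _ _).trans (mul_le_mul_of_nonneg_left
      (norm_pow_le' x n.succ_pos) (norm_nonneg _))
  have key2 : (a * x) * (1 - a * y) = 0 := by
    rw [← norm_le_zero_iff]
    refine ge_of_tendsto (hlim.comp (Filter.tendsto_add_atTop_nat 1)) ?_
    refine Filter.Eventually.of_forall fun n => ?_
    have : (a * x) * (1 - a * y) = x ^ (n + 1) * (a * (1 - a * y)) ^ (n + 1) := by
      rw [hpow, ← mul_assoc, ← (hcx.pow_pow (n + 1) (n + 1)).eq, hpn]
    rw [this]
    refine (norm_mul_le _ _).trans ?_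
    rw [mul_comm]
    exact mul_le_mul_of_nonneg_left (norm_pow_le' x n.succ_pos) (norm_nonneg _)
  constructor
  · rw [sub_mul, one_mul, sub_eq_zero] at key1
    exact key1
  · rw [mul_sub, mul_one, sub_eq_zero] at key2
    exact key2

/-- The generalized Drazin inverse is unique. -/
theorem IsGDrazinInverse.unique {A : Type*} [NormedRing A] [NormedAlgebra ℂ A] [CompleteSpace A]
    {a x y : A} (hx : IsGDrazinInverse a x) (hy : IsGDrazinInverse a y) : x = y := by
  have h : a * x = a * y := (hx.mul_eq hy).1.trans (hy.mul_eq hx).2.symm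
  calc x = x * (a * x) := by rw [← mul_assoc, hx.mul_mul_self]
    _ = x * a * y := by rw [h, mul_assoc]
    _ = y * a * y := by rw [← hx.comm, h, hy.comm]
    _ = y := hy.mul_mul_self

theorem IsGDrazinInverse.eq_gdInv {A : Type*} [NormedRing A] [NormedAlgebra ℂ A]
    [CompleteSpace A] {a x : A} (hx : IsGDrazinInverse a x) : aᵈ = x :=
  (GDInvertible.isGDrazinInverse ⟨x, hx⟩).unique hx

/-! Put p = aaᵈ and q = 1 - p. Multiplying the hypothesis on the right by p gives qbp = 0, so a + b
is block upper triangular for p, with diagonal blocks e and w = qb + aq and off-diagonal block s =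
pbq. The hypothesis also says that qb commutes with aq, which is quasinilpotent. Each corner
condition forces qb to be generalized Drazin invertible, so w is too, with inverse the series T = ∑
q(-a)ⁿ(bᵈ)ⁿ⁺¹ (`IsGDrazinInverse.add_quasinilpotent`; `intertwine` replaces (qb)ᵈ by bᵈ).

Since w is invertible in this sense, a + b is so exactly when e is (`GDInvertible.iff_mul_right`),
and the formula is that of a triangular element (`IsGDrazinInverse.triangular`) with these e, w, s,
T.

All analysis goes through one notion: u is quasinilpotent iff its powers are eventually smaller than
every geometric sequence. Such sequences absorb factors yⁿ and convolutions, and they are summable.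
-/

/-- A sequence decays rapidly if it is dominated by every geometric sequence. -/
def RapidDecay {A : Type*} [NormedRing A] (v : ℕ → A) : Prop :=
  ∀ ε : ℝ, 0 < ε → ∃ C : ℝ, 0 ≤ C ∧ ∀ n, ‖v n‖ ≤ C * ε ^ n

/-! ### Calculus of rapidly decaying sequences. -/

namespace RapidDecay

variable {A : Type*} [NormedRing A] {v w : ℕ → A}

theorem add (hv : RapidDecay v) (hw : RapidDecay w) : RapidDecay (fun n => v n + w n) := by
  intro ε hε
  obtain ⟨C, hC, h⟩ := hv ε hε
  obtain ⟨D, hD, k⟩ := hw ε hε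
  refine ⟨C + D, by positivity, fun n => (norm_add_le _ _).trans ?_⟩
  rw [add_mul]
  exact add_le_add (h n) (k n)

theorem const_mul (hv : RapidDecay v) (x : A) : RapidDecay (fun n => x * v n) := by
  intro ε hε
  obtain ⟨C, hC, h⟩ := hv ε hε
  refine ⟨‖x‖ * C, by positivity, fun n => (norm_mul_le _ _).trans ?_⟩
  rw [mul_assoc]
  exact mul_le_mul_of_nonneg_left (h n) (norm_nonneg _)

theorem mul_const (hv : RapidDecay v) (x : A) : RapidDecay (fun n => v n * x) := by
  intro ε hε
  obtain ⟨C, hC, h⟩ := hv ε hε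
  refine ⟨C * ‖x‖, by positivity, fun n => (norm_mul_le _ _).trans ?_⟩
  rw [mul_right_comm]
  exact mul_le_mul_of_nonneg_right (h n) (norm_nonneg _)

/-- Geometric growth at rate M is absorbed by using the decay of `v` at rate ε / M. -/
theorem of_norm_le_mul_pow {B : Type*} [NormedRing B] {w : ℕ → B} (hv : RapidDecay v)
    {K M : ℝ} (hK : 0 ≤ K) (hM : 0 < M)
    (h : ∀ n, ‖w n‖ ≤ K * M ^ n * ‖v n‖) : RapidDecay w := by
  intro ε hε
  obtain ⟨C, hC, hv⟩ := hv (ε / M) (by positivity)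
  refine ⟨K * C, by positivity, fun n => (h n).trans ?_⟩
  calc K * M ^ n * ‖v n‖ ≤ K * M ^ n * (C * (ε / M) ^ n) := by gcongr; exact hv n
    _ = K * C * ε ^ n := by rw [div_pow]; field_simp

/-- The factor in front is needed at n = 0, because ‖1‖ = 1 is not assumed. -/
theorem norm_pow_le_mul_pow (y : A) (n : ℕ) : ‖y ^ n‖ ≤ (‖(1 : A)‖ + 1) * (‖y‖ + 1) ^ n := by
  rcases n.eq_zero_or_pos with rfl | hn
  · simp
  · calc ‖y ^ n‖ ≤ ‖y‖ ^ n := norm_pow_le' y hn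
      _ ≤ (‖y‖ + 1) ^ n := by gcongr; linarith
      _ ≤ (‖(1 : A)‖ + 1) * (‖y‖ + 1) ^ n :=
        le_mul_of_one_le_left (by positivity) (by linarith [norm_nonneg (1 : A)])

theorem pow_mul (hv : RapidDecay v) (y : A) : RapidDecay (fun n => y ^ n * v n) :=
  hv.of_norm_le_mul_pow (K := ‖(1 : A)‖ + 1) (M := ‖y‖ + 1) (by positivity) (by positivity)
    fun n => (norm_mul_le _ _).trans
      (mul_le_mul_of_nonneg_right (norm_pow_le_mul_pow y n) (norm_nonneg _))

theorem mul_pow (hv : RapidDecay v) (y : A) : RapidDecay (fun n => v n * y ^ n) :=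
  hv.of_norm_le_mul_pow (K := ‖(1 : A)‖ + 1) (M := ‖y‖ + 1) (by positivity) (by positivity)
    fun n => (norm_mul_le _ _).trans (by
      rw [mul_comm]
      exact mul_le_mul_of_nonneg_right (norm_pow_le_mul_pow y n) (norm_nonneg _))

theorem summable [CompleteSpace A] (hv : RapidDecay v) : Summable v := by
  obtain ⟨C, -, h⟩ := hv (1 / 2) (by norm_num)
  exact Summable.of_norm_bounded
    ((summable_geometric_of_lt_one (by norm_num) (by norm_num)).mul_left C) h

/-- The device behind the vanishing statements below: rewrite a fixed element, for every n, as the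
n-th term of a rapidly decaying sequence. -/
theorem eq_zero_of_const {x : A} (hx : RapidDecay (fun _ => x)) : x = 0 := by
  obtain ⟨C, -, h⟩ := hx (1 / 2) (by norm_num)
  rw [← norm_le_zero_iff]
  have := (tendsto_pow_atTop_nhds_zero_of_lt_one (r := (1 / 2 : ℝ)) (by norm_num)
    (by norm_num)).const_mul C
  rw [mul_zero] at this
  exact ge_of_tendsto' this h

/-- Allows formulas for powers that hold only from exponent 1 on. -/
theorem of_succ (h : RapidDecay (fun n => v (n + 1))) : RapidDecay v := by
  intro ε hε
  obtain ⟨C, hC, h⟩ := h ε hε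
  refine ⟨‖v 0‖ + C / ε, by positivity, fun n => ?_⟩
  rcases n with _ | n
  · have : 0 ≤ C / ε := by positivity
    simpa using this
  · calc ‖v (n + 1)‖ ≤ C * ε ^ n := h n
      _ = C / ε * ε ^ (n + 1) := by rw [pow_succ]; field_simp
      _ ≤ _ := by gcongr; linarith [norm_nonneg (v 0)]

/-- The binomial coefficients sum to 2ⁿ, which decay at rate ε / 2 compensates. -/
theorem sum_choose_antidiagonal (hv : RapidDecay v) (hw : RapidDecay w) :
    RapidDecay (fun n => ∑ ij ∈ Finset.HasAntidiagonal.antidiagonal n, n.choose ij.1 • (v ij.1 * w ij.2)) := by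
  intro ε hε
  obtain ⟨C, hC, h⟩ := hv (ε / 2) (by positivity)
  obtain ⟨D, hD, k⟩ := hw (ε / 2) (by positivity)
  refine ⟨C * D, by positivity, fun n => ?_⟩
  calc ‖∑ ij ∈ Finset.HasAntidiagonal.antidiagonal n, n.choose ij.1 • (v ij.1 * w ij.2)‖
      ≤ ∑ ij ∈ Finset.HasAntidiagonal.antidiagonal n, n.choose ij.1 • (C * D * (ε / 2) ^ n) := by
        refine norm_sum_le_of_le _ fun ij hij => (norm_nsmul_le).trans ?_
        rw [nsmul_eq_mul]
        refine mul_le_mul_of_nonneg_left ((norm_mul_le _ _).trans ?_) (Nat.cast_nonneg _)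
        calc ‖v ij.1‖ * ‖w ij.2‖ ≤ C * (ε / 2) ^ ij.1 * (D * (ε / 2) ^ ij.2) :=
              mul_le_mul (h _) (k _) (norm_nonneg _) (by positivity)
          _ = C * D * (ε / 2) ^ n := by rw [← Finset.HasAntidiagonal.mem_antidiagonal.1 hij, pow_add]; ring
    _ = C * D * ε ^ n := by
      rw [← Finset.sum_smul, Finset.Nat.sum_antidiagonal_eq_sum_range_succ_mk]
      simp only
      rw [Nat.sum_range_choose, nsmul_eq_mul, div_pow]
      push_cast
      field_simp

theorem sum_antidiagonal (hv : RapidDecay v) (hw : RapidDecay w) :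
    RapidDecay (fun n => ∑ ij ∈ Finset.HasAntidiagonal.antidiagonal n, v ij.1 * w ij.2) := by
  intro ε hε
  obtain ⟨C, hC, h⟩ := hv (ε / 2) (by positivity)
  obtain ⟨D, hD, k⟩ := hw (ε / 2) (by positivity)
  refine ⟨C * D, by positivity, fun n => ?_⟩
  calc ‖∑ ij ∈ Finset.HasAntidiagonal.antidiagonal n, v ij.1 * w ij.2‖
      ≤ ∑ _ij ∈ Finset.HasAntidiagonal.antidiagonal n, C * D * (ε / 2) ^ n := by
        refine norm_sum_le_of_le _ fun ij hij => (norm_mul_le _ _).trans ?_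
        calc ‖v ij.1‖ * ‖w ij.2‖ ≤ C * (ε / 2) ^ ij.1 * (D * (ε / 2) ^ ij.2) :=
              mul_le_mul (h _) (k _) (norm_nonneg _) (by positivity)
          _ = C * D * (ε / 2) ^ n := by rw [← Finset.HasAntidiagonal.mem_antidiagonal.1 hij, pow_add]; ring
    _ = C * D * ε ^ n * ((n + 1 : ℕ) / 2 ^ n) := by
      rw [Finset.sum_const, Finset.Nat.card_antidiagonal, nsmul_eq_mul, div_pow]
      ring
    _ ≤ C * D * ε ^ n := by
      refine mul_le_of_le_one_right (by positivity) ?_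
      rw [div_le_one (by positivity)]
      exact_mod_cast Nat.lt_two_pow_self (n := n)

end RapidDecay

/-! ### Quasinilpotence as rapid decay of powers. -/

section

variable {A : Type*} [NormedRing A] [NormedAlgebra ℂ A]

/-- Forward, `tendsto_mul_pow` is applied to a scalar of norm ε⁻¹, which exists unless the ring is
zero. Conversely, a spectral value k has |k|ⁿ ≤ ‖1‖‖uⁿ‖, so kⁿ decays rapidly; if k ≠ 0, multiplying
by k⁻ⁿ would make the constant 1 decay. -/
theorem isQuasinilpotent_iff_rapidDecay [CompleteSpace A] {u : A} :
    IsQuasinilpotent u ↔ RapidDecay (fun n => u ^ n) := by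
  refine ⟨fun hu ε hε => ?_, fun hu => ?_⟩
  · by_cases h1 : ‖(1 : A)‖ = 0
    · have : Subsingleton A := subsingleton_of_zero_eq_one (norm_eq_zero.1 h1).symm
      refine ⟨0, le_rfl, fun n => ?_⟩
      change ‖u ^ n‖ ≤ _
      rw [Subsingleton.elim (u ^ n) 0]
      simp
    · have hx : ‖((ε⁻¹ / ‖(1 : A)‖ : ℝ) : ℂ) • (1 : A)‖ = ε⁻¹ := by
        rw [norm_smul, Complex.norm_real, norm_div, norm_norm, div_mul_cancel₀ _ h1, norm_inv,
          Real.norm_of_nonneg hε.le]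
      obtain ⟨C, hC⟩ := (hu.tendsto_mul_pow (((ε⁻¹ / ‖(1 : A)‖ : ℝ) : ℂ) • (1 : A))).bddAbove_range
      rw [hx] at hC
      have hC' : ∀ n, ‖u ^ n‖ * ε⁻¹ ^ n ≤ C := fun n => hC ⟨n, rfl⟩
      refine ⟨C, le_trans (by positivity) (hC' 0), fun n => ?_⟩
      have := hC' n
      rwa [inv_pow, ← div_eq_mul_inv, div_le_iff₀ (by positivity)] at this
  · refine le_antisymm (iSup₂_le fun k hk => ?_) bot_le
    suffices k = 0 by simp [this]
    by_contra hk0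
    have hdecay : RapidDecay (fun n => k ^ n) := by
      refine hu.of_norm_le_mul_pow (K := ‖(1 : A)‖) (M := 1) (norm_nonneg _) one_pos fun n => ?_
      have := spectrum.norm_le_norm_mul_of_mem (spectrum.pow_mem_pow u n hk)
      simpa [mul_comm] using this
    have hone : RapidDecay (fun _ => (1 : ℂ)) := by
      have := hdecay.pow_mul k⁻¹
      simpa [← mul_pow, hk0] using this
    exact one_ne_zero hone.eq_zero_of_const

end

/-! ### Intertwining and commuting quasinilpotent perturbations. -/

section

variable {A : Type*} [NormedRing A] [NormedAlgebra ℂ A]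

namespace IsGDrazinInverse

variable {a x : A}

theorem isIdempotentElem (h : IsGDrazinInverse a x) : IsIdempotentElem (a * x) := by
  change a * x * (a * x) = a * x
  rw [mul_assoc, ← mul_assoc x, h.mul_mul_self]

theorem mul_idem (h : IsGDrazinInverse a x) : x * (a * x) = x := by
  rw [← mul_assoc, h.mul_mul_self]

theorem idem_mul (h : IsGDrazinInverse a x) : a * x * x = x := by
  rw [h.comm, h.mul_mul_self]

theorem commute_one_sub (h : IsGDrazinInverse a x) : Commute a (1 - a * x) :=
  (Commute.one_right a).sub_right ((Commute.refl a).mul_right h.comm)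

theorem pow_mul_pow (h : IsGDrazinInverse a x) (n : ℕ) : a ^ n * x ^ n * (a * x) = a * x := by
  have hc : Commute a x := h.comm
  rw [← hc.mul_pow, ← pow_succ, h.isIdempotentElem.pow_succ_eq]

theorem pow_mul_pow_mul (h : IsGDrazinInverse a x) (n : ℕ) : a ^ n * x ^ n * x = x := by
  calc a ^ n * x ^ n * x = a ^ n * x ^ n * (a * x) * x := by rw [mul_assoc _ (a * x), h.idem_mul]
    _ = x := by rw [h.pow_mul_pow, h.idem_mul]

end IsGDrazinInverse

variable [CompleteSpace A]

theorem IsQuasinilpotent.add_of_commute {u v : A} (hu : IsQuasinilpotent u)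
    (hv : IsQuasinilpotent v) (h : Commute u v) : IsQuasinilpotent (u + v) := by
  rw [isQuasinilpotent_iff_rapidDecay] at *
  simp_rw [h.add_pow']
  exact hu.sum_choose_antidiagonal hv

theorem IsQuasinilpotent.mul_of_commute {u v : A} (hu : IsQuasinilpotent u)
    (h : Commute u v) : IsQuasinilpotent (u * v) := by
  rw [isQuasinilpotent_iff_rapidDecay] at *
  simp_rw [h.mul_pow]
  exact hu.mul_pow v

theorem isQuasinilpotent_zero : IsQuasinilpotent (0 : A) := by
  rw [isQuasinilpotent_iff_rapidDecay]
  refine RapidDecay.of_succ fun ε hε => ⟨0, le_rfl, fun n => ?_⟩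
  simp

theorem isGDrazinInverse_zero : IsGDrazinInverse (0 : A) 0 :=
  ⟨by simp, by simp, by simpa using isQuasinilpotent_zero⟩

namespace IsGDrazinInverse

variable {a x : A}

/-- The terms are (a - a²x)ⁿ(1 - ax), since 1 - ax is an idempotent commuting with a; the last
factor makes n = 0 fit as well. -/
theorem rapidDecay (h : IsGDrazinInverse a x) : RapidDecay (fun n => a ^ n * (1 - a * x)) := by
  have hq := isQuasinilpotent_iff_rapidDecay.1 h.quasinilpotent
  have := hq.mul_const (1 - a * x)
  convert this using 2 with n
  have hu : a - a ^ 2 * x = a * (1 - a * x) := by noncomm_ring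
  have hi : IsIdempotentElem (1 - a * x) := h.isIdempotentElem.one_sub
  rw [hu, h.commute_one_sub.mul_pow, mul_assoc, ← pow_succ, hi.pow_succ_eq]

theorem rapidDecay' (h : IsGDrazinInverse a x) : RapidDecay (fun n => (1 - a * x) * a ^ n) := by
  convert h.rapidDecay using 2 with n
  exact (h.commute_one_sub.pow_left n).eq.symm

/-- Generalized Drazin inverses respect intertwining relations. -/
theorem intertwine {c y s : A} (hx : IsGDrazinInverse a x) (hy : IsGDrazinInverse c y)
    (h : a * s = s * c) : x * s = s * y := by
  have hpow : ∀ n : ℕ, a ^ n * s = s * c ^ n := fun n =>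
    ((show SemiconjBy s c a from h.symm).pow_right n).eq.symm
  have hxp : ∀ n : ℕ, x = x * (x ^ n * a ^ n) := fun n => by
    have hc : Commute a x := hx.comm
    rw [← (hc.pow_pow n n).eq]
    have := hx.pow_mul_pow_mul n
    rwa [((hc.pow_left n).mul_left ((Commute.refl x).pow_left n)).eq, eq_comm] at this
  -- For every n the left side equals x xⁿ s cⁿ(1 - cy), by x = x xⁿaⁿ and aⁿs = scⁿ. The next claim
  -- is symmetric.
  have h1 : x * s * (1 - c * y) = 0 := by
    refine RapidDecay.eq_zero_of_const ?_
    convert ((hy.rapidDecay.const_mul s).pow_mul x).const_mul x using 2 with n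
    rw [← mul_assoc s, ← hpow, ← mul_assoc _ _ (1 - c * y), ← mul_assoc _ _ (1 - c * y),
      ← mul_assoc _ _ s, ← mul_assoc x _ s, ← hxp]
  have h2 : (1 - a * x) * s * y = 0 := by
    refine RapidDecay.eq_zero_of_const ?_
    convert ((hx.rapidDecay'.mul_const s).mul_pow y).mul_const y using 2 with n
    have hn := hy.pow_mul_pow_mul n
    rw [mul_assoc] at hn
    rw [mul_assoc _ _ s, hpow]
    simp only [mul_assoc, hn]
  have h3 : x * s = x * s * (c * y) := by
    rw [← sub_eq_zero, ← h1]; noncomm_ring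
  have h4 : s * y = a * x * s * y := by
    rw [← sub_eq_zero, ← h2]; noncomm_ring
  rw [h3, h4, hx.comm, mul_assoc x a s, h]
  simp only [mul_assoc]

/-- Adding a commuting quasinilpotent element preserves generalized Drazin invertibility. -/
theorem add_quasinilpotent {u : A} (h : IsGDrazinInverse a x) (hu : IsQuasinilpotent u)
    (hc : Commute a u) :
    RapidDecay (fun n => (-u) ^ n * x ^ (n + 1)) ∧
    IsGDrazinInverse (a + u) (∑' n : ℕ, (-u) ^ n * x ^ (n + 1)) := by
  have hcx : Commute a x := h.comm
  have hux : Commute x u := h.intertwine h hc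
  have hneg : RapidDecay (fun n => (-u) ^ n) := by
    refine (isQuasinilpotent_iff_rapidDecay.1 hu).of_norm_le_mul_pow (K := 1) (M := 1)
      zero_le_one one_pos fun n => ?_
    rcases n.even_or_odd with hn | hn
    · simp [hn.neg_pow]
    · simp [hn.neg_pow]
  have hd : RapidDecay (fun n => (-u) ^ n * x ^ (n + 1)) := by
    convert (hneg.mul_pow x).mul_const x using 2 with n
    rw [mul_assoc, ← pow_succ]
  refine ⟨hd, ?_⟩
  have hs := hd.summable
  set T : A := ∑' n : ℕ, (-u) ^ n * x ^ (n + 1) with hT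
  have hcomm : ∀ z : A, Commute z u → Commute z x → Commute z T := fun z h1 h2 => by
    change z * T = T * z
    rw [hT, ← hs.tsum_mul_left, ← hs.tsum_mul_right]
    exact tsum_congr fun n =>
      ((h1.neg_right.pow_right n).mul_right (h2.pow_right (n + 1))).eq
  have haT : Commute a T := hcomm a hc hcx
  have huT : Commute u T := hcomm u (Commute.refl u) hux.symm
  have hxT : Commute x T := hcomm x hux (Commute.refl x)
  -- Splitting off the first term. With axT = T this yields (a + u)T = ax, from which the axioms
  -- follow.
  have hrec : T = x - u * x * T := by
    conv_lhs => rw [hT, hs.tsum_eq_zero_add]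
    rw [pow_zero, one_mul, zero_add, pow_one, sub_eq_add_neg, ← neg_mul, hT, ← hs.tsum_mul_left]
    congr 1
    refine tsum_congr fun n => ?_
    rw [pow_succ' (-u), pow_succ' x (n + 1), ← neg_mul]
    simp only [mul_assoc]
    rw [(hux.neg_right.pow_right n).left_comm]
  have hidT : a * x * T = T := by
    rw [hT, ← hs.tsum_mul_left]
    refine tsum_congr fun n => ?_
    rw [((((hc.mul_left hux).neg_right).pow_right n)).left_comm, pow_succ' x, ← mul_assoc (a * x),
      h.idem_mul]
  have hkey : (a + u) * T = a * x := by
    have : a * T = a * x - u * T := by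
      conv_lhs => rw [hrec]
      rw [mul_sub, mul_assoc u, hc.left_comm, ← mul_assoc a x, hidT]
    rw [add_mul, this, sub_add_cancel]
  refine ⟨?_, ((haT.add_left huT)).eq, ?_⟩
  · rw [mul_assoc, hkey, ← (haT.mul_left hxT).eq, hidT]
  · have : a + u - (a + u) ^ 2 * T = a - a ^ 2 * x + u * (1 - a * x) := by
      rw [pow_two, mul_assoc, hkey]; noncomm_ring
    rw [this]
    have hu1 : Commute u (1 - a * x) :=
      (Commute.one_right u).sub_right (hc.symm.mul_right hux.symm)
    have ha1 : Commute u (a - a ^ 2 * x) :=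
      hc.symm.sub_right ((hc.symm.pow_right 2).mul_right hux.symm)
    refine h.quasinilpotent.add_of_commute (hu.mul_of_commute hu1) ?_
    refine ha1.symm.mul_right ?_
    have : a - a ^ 2 * x = a * (1 - a * x) := by noncomm_ring
    rw [this]
    exact h.commute_one_sub.mul_left (Commute.refl _)

end IsGDrazinInverse

end

/-! ### Block triangular elements. -/

section

variable {A : Type*} [NormedRing A] [NormedAlgebra ℂ A]

namespace IsGDrazinInverse

variable {p e e' : A}

theorem mul_eq_self (h : IsGDrazinInverse e e') (hep : e * p = e) : e' * p = e' := by
  conv_lhs => rw [← h.mul_idem, h.comm, mul_assoc, mul_assoc, hep]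
  rw [← h.comm, h.mul_idem]

theorem self_mul_eq (h : IsGDrazinInverse e e') (hpe : p * e = e) : p * e' = e' := by
  conv_lhs => rw [← h.idem_mul, ← mul_assoc, ← mul_assoc, hpe]
  rw [h.idem_mul]

theorem mul_eq_zero (h : IsGDrazinInverse e e') (hep : e * p = 0) : e' * p = 0 := by
  rw [← h.mul_idem, h.comm, mul_assoc, mul_assoc, hep]; simp

theorem self_mul_eq_zero (h : IsGDrazinInverse e e') (hpe : p * e = 0) : p * e' = 0 := by
  rw [← h.idem_mul, ← mul_assoc, ← mul_assoc, hpe]; simp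

end IsGDrazinInverse

variable [CompleteSpace A]

/-- A block triangular element with quasinilpotent diagonal blocks is quasinilpotent. -/
theorem IsQuasinilpotent.triangular {p e w s : A} (hep : e * p = e) (hpe : p * e = e)
    (hwp : w * p = 0) (hpw : p * w = 0) (hsp : s * p = 0) (hps : p * s = s)
    (he : IsQuasinilpotent e) (hw : IsQuasinilpotent w) : IsQuasinilpotent (e + w + s) := by
  rw [isQuasinilpotent_iff_rapidDecay] at *
  have hew : ∀ t, e * (w * t) = 0 := fun t => by rw [← hep, mul_assoc, ← mul_assoc p, hpw]; simp
  have hwe : ∀ t, w * (e * t) = 0 := fun t => by rw [← hpe, ← mul_assoc, ← mul_assoc, hwp]; simp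
  have hse : ∀ t, s * (e * t) = 0 := fun t => by rw [← hpe, ← mul_assoc, ← mul_assoc, hsp]; simp
  have hws : ∀ t, w * (s * t) = 0 := fun t => by rw [← hps, ← mul_assoc, ← mul_assoc, hwp]; simp
  have hss : ∀ t, s * (s * t) = 0 := fun t => by
    conv_lhs => rw [← hps, ← mul_assoc, ← mul_assoc, mul_assoc p, hsp]
    simp
  -- Only words eⁱ s wʲ mix the blocks: s can occur at most once, with e to its left and w to its
  -- right.
  have hpow : ∀ n : ℕ, (e + w + s) ^ (n + 1) = e * e ^ n + w * w ^ n +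
      ∑ ij ∈ Finset.HasAntidiagonal.antidiagonal n, e ^ ij.1 * (s * w ^ ij.2) := by
    intro n
    induction n with
    | zero => simp
    | succ n ih =>
      rw [pow_succ', ih, Finset.Nat.sum_antidiagonal_succ, pow_succ' e, pow_succ' w]
      simp only [mul_add, add_mul, Finset.mul_sum, hew, hwe, hse]
      have h1 : ∀ ij : ℕ × ℕ, w * (e ^ ij.1 * (s * w ^ ij.2)) = 0 := fun ij => by
        rcases ij with ⟨_ | i, j⟩
        · simp [hws]
        · rw [pow_succ', mul_assoc, hwe]
      have h2 : ∀ ij : ℕ × ℕ, s * (e ^ ij.1 * (s * w ^ ij.2)) = 0 := fun ij => by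
        rcases ij with ⟨_ | i, j⟩
        · simp [hss]
        · rw [pow_succ', mul_assoc, hse]
      simp only [h1, h2, add_zero, pow_zero, one_mul, pow_succ', mul_assoc]
      abel
  refine RapidDecay.of_succ ?_
  simp_rw [hpow]
  exact ((he.const_mul e).add (hw.const_mul w)).add (he.sum_antidiagonal (hw.const_mul s))

/-- Invariance lets the inner factors p be dropped from the powers of zp. -/
theorem IsQuasinilpotent.compress_left {p z : A} (h : z * p = p * z * p)
    (hz : IsQuasinilpotent z) : IsQuasinilpotent (z * p) := by
  rw [isQuasinilpotent_iff_rapidDecay] at *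
  refine RapidDecay.of_succ ?_
  have hpow : ∀ n : ℕ, (z * p) ^ (n + 1) = z ^ n * (z * p) := fun n => by
    induction n with
    | zero => simp
    | succ n ih => rw [pow_succ, ih, mul_assoc, mul_assoc z, ← mul_assoc p, ← h, pow_succ]
                   simp only [mul_assoc]
  simp_rw [hpow]
  exact hz.mul_const _

theorem IsQuasinilpotent.compress_right {p z : A} (h : p * z = p * z * p)
    (hz : IsQuasinilpotent z) : IsQuasinilpotent (p * z) := by
  rw [isQuasinilpotent_iff_rapidDecay] at *
  refine RapidDecay.of_succ ?_
  have hpow : ∀ n : ℕ, (p * z) ^ (n + 1) = p * z * z ^ n := fun n => by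
    induction n with
    | zero => simp
    | succ n ih => rw [pow_succ', ih, ← mul_assoc, ← mul_assoc, ← h, pow_succ']
                   simp only [mul_assoc]
  simp_rw [hpow]
  exact hz.const_mul _

namespace IsGDrazinInverse

theorem compress_left {p x y : A} (h : IsGDrazinInverse x y) (hx : x * p = p * x * p)
    (hy : y * p = p * y * p) : IsGDrazinInverse (x * p) (y * p) := by
  have hmul : ∀ r t : A, t * p = p * t * p → r * p * (t * p) = r * t * p := fun r t ht => by
    rw [mul_assoc, ← mul_assoc p, ← ht, mul_assoc]
  have htri : ∀ r t : A, r * p = p * r * p → t * p = p * t * p → r * t * p = p * (r * t) * p :=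
    fun r t hr ht => calc
      r * t * p = r * p * (t * p) := (hmul r t ht).symm
      _ = p * (r * p * (t * p)) := by rw [← mul_assoc p, ← mul_assoc p r p, ← hr]
      _ = p * (r * t) * p := by rw [hmul _ _ ht, mul_assoc p]
  refine ⟨?_, ?_, ?_⟩
  · rw [hmul _ _ hx, hmul _ _ hy, h.mul_mul_self]
  · rw [hmul _ _ hx, hmul _ _ hy, h.comm]
  · have : x * p - (x * p) ^ 2 * (y * p) = (x - x ^ 2 * y) * p := by
      rw [pow_two, hmul _ _ hx, hmul _ _ hy, sub_mul, pow_two]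
    rw [this]
    refine h.quasinilpotent.compress_left ?_
    rw [sub_mul, mul_sub, sub_mul, pow_two, ← hx, ← htri _ _ (htri _ _ hx hx) hy]

theorem compress_right {p x y : A} (h : IsGDrazinInverse x y) (hx : p * x = p * x * p)
    (hy : p * y = p * y * p) : IsGDrazinInverse (p * x) (p * y) := by
  have hmul : ∀ r t : A, p * r = p * r * p → p * r * (p * t) = p * (r * t) := fun r t hr => by
    rw [← mul_assoc, ← hr, mul_assoc]
  have htri : ∀ r t : A, p * r = p * r * p → p * t = p * t * p → p * (r * t) = p * (r * t) * p :=
    fun r t hr ht => calc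
      p * (r * t) = p * r * (p * t) := (hmul r t hr).symm
      _ = p * r * (p * t) * p := by rw [mul_assoc (p * r), ← ht]
      _ = p * (r * t) * p := by rw [hmul _ _ hr]
  refine ⟨?_, ?_, ?_⟩
  · rw [hmul _ _ hy, hmul _ _ (htri _ _ hy hx), h.mul_mul_self]
  · rw [hmul _ _ hx, hmul _ _ hy, h.comm]
  · have : p * x - (p * x) ^ 2 * (p * y) = p * (x - x ^ 2 * y) := by
      rw [pow_two, hmul _ _ hx, hmul _ _ (htri _ _ hx hx), mul_sub, pow_two]
    rw [this]
    refine h.quasinilpotent.compress_right ?_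
    rw [mul_sub, sub_mul, pow_two, ← hx, ← htri _ _ (htri _ _ hx hx) hy]

variable {p e w s e' w' : A}

/-- The generalized Drazin inverse of a block triangular element. -/
theorem triangular (hep : e * p = e) (hpe : p * e = e) (hwp : w * p = 0) (hpw : p * w = 0)
    (hsp : s * p = 0) (hps : p * s = s) (he : IsGDrazinInverse e e')
    (hw : IsGDrazinInverse w w') :
    Summable (fun n : ℕ => (1 - e * e') * e ^ n * s * w' ^ (n + 2)) ∧
    Summable (fun n : ℕ => e' ^ (n + 2) * s * (w ^ n * (1 - w * w'))) ∧
    IsGDrazinInverse (e + w + s) (e' + w' - e' * s * w'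
      + (∑' n : ℕ, (1 - e * e') * e ^ n * s * w' ^ (n + 2))
      + ∑' n : ℕ, e' ^ (n + 2) * s * (w ^ n * (1 - w * w'))) := by
  have hQ : Summable (fun n : ℕ => (1 - e * e') * e ^ n * s * w' ^ (n + 2)) := by
    convert (((he.rapidDecay'.mul_const s).mul_pow w').mul_const (w' ^ 2)).summable using 2 with n
    rw [pow_add, ← mul_assoc]
  have hP : Summable (fun n : ℕ => e' ^ (n + 2) * s * (w ^ n * (1 - w * w'))) := by
    convert (((hw.rapidDecay.const_mul s).pow_mul e').const_mul (e' ^ 2)).summable using 2 with n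
    rw [add_comm n 2, pow_add]
    simp only [mul_assoc]
  refine ⟨hQ, hP, ?_⟩
  set Q := ∑' n : ℕ, (1 - e * e') * e ^ n * s * w' ^ (n + 2) with hQd
  set P := ∑' n : ℕ, e' ^ (n + 2) * s * (w ^ n * (1 - w * w')) with hPd
  have he'p := he.mul_eq_self hep
  have hpe' := he.self_mul_eq hpe
  have hw'p := hw.mul_eq_zero hwp
  have hpw' := hw.self_mul_eq_zero hpw
  have hce : e * (1 - e * e') = (1 - e * e') * e := he.commute_one_sub.eq
  have hee : e * e' * (1 - e * e') = 0 := by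
    rw [mul_sub, mul_one, he.isIdempotentElem.eq, sub_self]
  have hww : (1 - w * w') * (w * w') = 0 := by
    rw [sub_mul, one_mul, hw.isIdempotentElem.eq, sub_self]
  -- Shifting the index in P, and likewise in Q, leaves only boundary terms; these combine in
  -- `hsyl`.
  have heP : e * P = e' * s * (1 - w * w') + P * w := by
    rw [hPd, ← hP.tsum_mul_left, ← hP.tsum_mul_right,
      ((hP.mul_left e).tsum_eq_zero_add)]
    congr 1
    · rw [pow_zero, one_mul, zero_add, pow_two, ← mul_assoc, ← mul_assoc, ← mul_assoc, he.idem_mul]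
    · refine tsum_congr fun n => ?_
      rw [pow_succ' e', pow_succ' e', pow_succ' e', pow_succ w]
      simp only [mul_assoc]
      rw [(hw.commute_one_sub).eq, ← mul_assoc e' e', ← mul_assoc e, ← mul_assoc e, he.idem_mul]
  have hQw : Q * w = (1 - e * e') * s * w' + e * Q := by
    rw [hQd, ← hQ.tsum_mul_left, ← hQ.tsum_mul_right,
      ((hQ.mul_right w).tsum_eq_zero_add)]
    have hwww : w' * (w' * w) = w' := by rw [← hw.comm, hw.mul_idem]
    congr 1
    · rw [pow_zero, mul_one, zero_add, pow_two, mul_assoc, mul_assoc w', hwww]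
    · refine tsum_congr fun n => ?_
      rw [← mul_assoc e, ← mul_assoc e, ← mul_assoc e, hce, pow_succ' e, pow_succ w' (n + 2),
        pow_succ w' (n + 1)]
      simp only [mul_assoc, hwww]
  have heeP : e * e' * P = P := by
    rw [hPd, ← hP.tsum_mul_left]
    refine tsum_congr fun n => ?_
    rw [pow_succ' e' (n + 1)]
    simp only [← mul_assoc, he.idem_mul]
  have hPww : P * (w * w') = 0 := by
    rw [hPd, ← hP.tsum_mul_right]
    simp only [mul_assoc, hww, mul_zero, tsum_zero]
  have heeQ : e * e' * Q = 0 := by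
    rw [hQd, ← hQ.tsum_mul_left]
    simp only [← mul_assoc, hee, zero_mul, tsum_zero]
  have hQww : Q * (w * w') = Q := by
    rw [hQd, ← hQ.tsum_mul_right]
    refine tsum_congr fun n => ?_
    rw [pow_succ w' (n + 1)]
    simp only [mul_assoc, hw.mul_idem]
  have hpQ : p * Q = Q := by
    rw [hQd, ← hQ.tsum_mul_left]
    refine tsum_congr fun n => ?_
    rw [← (he.commute_one_sub.pow_left n).eq]
    rcases n with _ | n
    · simp only [pow_zero, one_mul, sub_mul, mul_sub, ← mul_assoc, hps, hpe]
    · simp only [pow_succ', ← mul_assoc, hpe]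
  have hQp : Q * p = 0 := by
    rw [hQd, ← hQ.tsum_mul_right]
    simp only [pow_succ _ (_ + 1), mul_assoc, hw'p, mul_zero, tsum_zero]
  have hpP : p * P = P := by
    rw [hPd, ← hP.tsum_mul_left]
    refine tsum_congr fun n => ?_
    simp only [pow_succ' _ (_ + 1), ← mul_assoc, hpe']
  have hPp : P * p = 0 := by
    rw [hPd, ← hP.tsum_mul_right]
    have : ∀ n : ℕ, s * (w ^ n * ((1 - w * w') * p)) = 0 := fun n => by
      rw [sub_mul, one_mul, mul_assoc, hw'p, mul_zero, sub_zero]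
      rcases n with _ | n
      · simp [hsp]
      · rw [pow_succ, mul_assoc, hwp]; simp
    simp only [mul_assoc, this, mul_zero, tsum_zero]
  obtain ⟨S, hS⟩ : ∃ S, S = - (e' * s * w') + Q + P := ⟨_, rfl⟩
  have hx : e' + w' - e' * s * w' + Q + P = e' + w' + S := by rw [hS]; abel
  rw [hx]
  have hpS : p * S = S := by
    rw [hS, mul_add, mul_add, hpQ, hpP, mul_neg, ← mul_assoc, ← mul_assoc, hpe']
  have hSp : S * p = 0 := by
    rw [hS, add_mul, add_mul, hQp, hPp, neg_mul, mul_assoc, hw'p]; simp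
  have hsyl : e * S + s * w' = e' * s + S * w := by
    rw [hS]
    simp only [mul_add, add_mul, heP, hQw, mul_sub, sub_mul, neg_mul, mul_neg, one_mul, mul_one,
      mul_assoc, hw.comm]
    abel
  have hSS : e * e' * S + S * (w * w') + e' * s * w' = S := by
    have h1 : e * e' * (e' * s * w') = e' * s * w' := by
      simp only [← mul_assoc, he.idem_mul]
    have h2 : e' * s * w' * (w * w') = e' * s * w' := by
      simp only [mul_assoc, hw.mul_idem]
    rw [hS]
    simp only [mul_add, add_mul, heeP, heeQ, hPww, hQww, neg_mul, mul_neg, h1, h2]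
    abel
  -- products of blocks vanish when the inner indices differ
  have hz : ∀ {r t : A}, r * p = r → p * t = 0 → r * t = 0 := fun {r t} hr ht => by
    rw [← hr, mul_assoc, ht, mul_zero]
  have hz' : ∀ {r t : A}, r * p = 0 → p * t = t → r * t = 0 := fun {r t} hr ht => by
    rw [← ht, ← mul_assoc, hr, zero_mul]
  have hxx : (e + w + s) * (e' + w' + S) = e * e' + w * w' + (e * S + s * w') := by
    simp only [add_mul, mul_add, hz hep hpw', hz' hwp hpe', hz' hwp hpS, hz' hsp hpe', hz' hsp hpS]
    abel
  have hxx' : (e' + w' + S) * (e + w + s) = e * e' + w * w' + (e * S + s * w') := by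
    rw [hsyl, he.comm, hw.comm]
    simp only [add_mul, mul_add, hz he'p hpw, hz' hw'p hpe, hz' hw'p hps, hz' hSp hpe, hz' hSp hps]
    abel
  refine ⟨?_, hxx.trans hxx'.symm, ?_⟩
  · have e1 : e * e' * w' = 0 := by rw [mul_assoc, hz he'p hpw', mul_zero]
    have e2 : w * w' * e' = 0 := by rw [mul_assoc, hz' hw'p hpe', mul_zero]
    have e3 : w * w' * S = 0 := by rw [mul_assoc, hz' hw'p hpS, mul_zero]
    have e4 : S * w * e' = 0 := by rw [mul_assoc, hz' hwp hpe', mul_zero]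
    have e5 : S * w * S = 0 := by rw [mul_assoc, hz' hwp hpS, mul_zero]
    have e6 : e' * s * e' = 0 := by rw [mul_assoc, hz' hsp hpe', mul_zero]
    have e7 : e' * s * S = 0 := by rw [mul_assoc, hz' hsp hpS, mul_zero]
    rw [hxx', hsyl]
    simp only [add_mul, mul_add, e1, e2, e3, e4, e5, e6, e7, he.idem_mul, hw.idem_mul]
    conv_rhs => rw [← hSS]
    simp only [mul_assoc]
    abel
  · have e8 : e * (w * w') = 0 := by rw [← mul_assoc, hz hep hpw, zero_mul]
    have e9 : w * (e * e') = 0 := by rw [← mul_assoc, hz' hwp hpe, zero_mul]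
    have e10 : w * (e * S) = 0 := by rw [← mul_assoc, hz' hwp hpe, zero_mul]
    have e11 : w * (s * w') = 0 := by rw [← mul_assoc, hz' hwp hps, zero_mul]
    have e12 : s * (e * e') = 0 := by rw [← mul_assoc, hz' hsp hpe, zero_mul]
    have e13 : s * (e * S) = 0 := by rw [← mul_assoc, hz' hsp hpe, zero_mul]
    have e14 : s * (s * w') = 0 := by rw [← mul_assoc, hz' hsp hps, zero_mul]
    -- The remainder is again block triangular, and its diagonal blocks are the quasinilpotent
    -- remainders of e and w.
    have hdec : (e + w + s) - (e + w + s) ^ 2 * (e' + w' + S) =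
        (e - e ^ 2 * e') + (w - w ^ 2 * w') +
        (s - e * (e * S) - e * (s * w') - s * (w * w')) := by
      rw [pow_two, mul_assoc, hxx, pow_two, pow_two, mul_assoc e, mul_assoc w]
      simp only [add_mul, mul_add, e8, e9, e10, e11, e12, e13, e14]
      abel
    rw [hdec]
    refine IsQuasinilpotent.triangular (p := p) ?_ ?_ ?_ ?_ ?_ ?_ he.quasinilpotent
      hw.quasinilpotent
    · rw [sub_mul, hep, mul_assoc, he'p]
    · rw [mul_sub, pow_two, ← mul_assoc, ← mul_assoc, hpe]
    · rw [sub_mul, hwp, mul_assoc, hw'p]; simp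
    · rw [mul_sub, pow_two, ← mul_assoc, ← mul_assoc, hpw]; simp
    · simp only [sub_mul, mul_assoc, hsp, hSp, hw'p, mul_zero, sub_zero]
    · simp only [mul_sub, ← mul_assoc, hps, hpe]

end IsGDrazinInverse

end

/-! ### Two out of three: a triangular element and its diagonal blocks. -/

section

variable {A : Type*} [NormedRing A] [NormedAlgebra ℂ A] [CompleteSpace A]

namespace GDInvertible

variable {p x : A}

theorem of_triangular (hp : IsIdempotentElem p) (hx : x * p = p * x * p)
    (h1 : GDInvertible (x * p)) (h2 : GDInvertible ((1 - p) * x)) : GDInvertible x := by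
  obtain ⟨e', he⟩ := h1
  obtain ⟨w', hw⟩ := h2
  have hdec : x * p + (1 - p) * x + p * x * (1 - p) = x := by
    rw [sub_mul, mul_sub, one_mul, mul_one, ← hx]; abel
  have := (he.triangular (p := p) (s := p * x * (1 - p)) ?_ ?_ ?_ ?_ ?_ ?_ hw).2.2
  · rw [hdec] at this
    exact ⟨_, this⟩
  · rw [mul_assoc, hp.eq]
  · rw [← mul_assoc, ← hx]
  · rw [sub_mul, sub_mul, one_mul, ← hx, sub_self]
  · rw [← mul_assoc, hp.mul_one_sub_self, zero_mul]
  · rw [mul_assoc, hp.one_sub_mul_self, mul_zero]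
  · rw [← mul_assoc, ← mul_assoc, hp.eq]

/-- Compressing the inverse y of x requires yp = pyp. This is where the other block enters: p
intertwines xp with x, hence their inverses, so yp = pc. -/
theorem one_sub_mul (hp : IsIdempotentElem p) (hx : x * p = p * x * p)
    (h : GDInvertible x) (h1 : GDInvertible (x * p)) : GDInvertible ((1 - p) * x) := by
  obtain ⟨y, hy⟩ := h
  obtain ⟨c, hc⟩ := h1
  have hyp : y * p = p * c := hy.intertwine hc (by rw [← mul_assoc, ← hx])
  refine ⟨_, hy.compress_right (p := 1 - p) ?_ ?_⟩
  · simp only [sub_mul, mul_sub, one_mul, mul_one, ← hx]; abel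
  · have : y * p = p * y * p := by rw [mul_assoc, hyp, ← mul_assoc, hp.eq]
    simp only [sub_mul, mul_sub, one_mul, mul_one, ← this]; abel

/-- Dual argument: 1 - p intertwines x with (1 - p)x, so (1 - p)y = c(1 - p), which p annihilates on
the right. -/
theorem mul_right (hp : IsIdempotentElem p) (hx : x * p = p * x * p)
    (h : GDInvertible x) (h1 : GDInvertible ((1 - p) * x)) : GDInvertible (x * p) := by
  obtain ⟨y, hy⟩ := h
  obtain ⟨c, hc⟩ := h1
  have hqy : c * (1 - p) = (1 - p) * y := hc.intertwine hy (by
    simp only [sub_mul, mul_sub, one_mul, mul_one, ← hx]; abel)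
  refine ⟨_, hy.compress_left hx ?_⟩
  rw [← sub_eq_zero]
  calc y * p - p * y * p = (1 - p) * y * p := by rw [sub_mul, sub_mul, one_mul]
    _ = 0 := by rw [← hqy, mul_assoc, hp.one_sub_mul_self, mul_zero]

theorem iff_mul_right (hp : IsIdempotentElem p) (hx : x * p = p * x * p)
    (h1 : GDInvertible ((1 - p) * x)) : GDInvertible x ↔ GDInvertible (x * p) :=
  ⟨fun h => h.mul_right hp hx h1, fun h => of_triangular hp hx h h1⟩

end GDInvertible

end

/-! ### The additive formula. -/

theorem corollary2p7 {A : Type*} [NormedRing A] [NormedAlgebra ℂ A] [CompleteSpace A]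
    (a b : A) (ha : GDInvertible a) (hb : GDInvertible b)
    (hab : aᵖⁱ * b * a = aᵖⁱ * a * b * aᵖⁱ)
    (hcorner : GDInvertible (aᵖⁱ * b * aᵖⁱ) ∨ GDInvertible (aᵖⁱ * b) ∨ GDInvertible (b * aᵖⁱ) ∨
      GDInvertible (a * aᵈ * b * a * aᵈ) ∨ GDInvertible (a * aᵈ * b) ∨
      GDInvertible (b * a * aᵈ))
    (e : A) (he : e = (a + b) * a * aᵈ) :
    ((GDInvertible (a + b) ↔ GDInvertible (a * aᵈ * (a + b))) ∧
      (GDInvertible (a * aᵈ * (a + b)) ↔ GDInvertible e) ∧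
      (GDInvertible e ↔ GDInvertible (a * aᵈ * (a + b) * a * aᵈ))) ∧
    (GDInvertible (a + b) →
      Summable (fun n : ℕ => aᵖⁱ * (-a) ^ n * bᵈ ^ (n + 1)) ∧
      Summable (fun n : ℕ => eᵈ * b * aᵖⁱ * (-a) ^ n * bᵈ ^ (n + 1)) ∧
      Summable (fun n : ℕ => eᵖⁱ * e ^ n * a * aᵈ * b *
        (∑' k : ℕ, aᵖⁱ * (-a) ^ k * bᵈ ^ (k + 1)) ^ (n + 2)) ∧
      (∀ n : ℕ, Summable (fun k : ℕ =>
        eᵈ ^ (n + 2) * b * aᵖⁱ * (a + b) ^ (n + 1) * aᵖⁱ * (-a) ^ k * bᵈ ^ (k + 1))) ∧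
      Summable (fun n : ℕ => eᵈ ^ (n + 2) * b * aᵖⁱ * (a + b) ^ n -
        ∑' k : ℕ,
          eᵈ ^ (n + 2) * b * aᵖⁱ * (a + b) ^ (n + 1) * aᵖⁱ * (-a) ^ k * bᵈ ^ (k + 1)) ∧
      (a + b)ᵈ = eᵈ + (∑' n : ℕ, aᵖⁱ * (-a) ^ n * bᵈ ^ (n + 1))
        - (∑' n : ℕ, eᵈ * b * aᵖⁱ * (-a) ^ n * bᵈ ^ (n + 1))
        + (∑' n : ℕ, eᵖⁱ * e ^ n * a * aᵈ * b *
            (∑' k : ℕ, aᵖⁱ * (-a) ^ k * bᵈ ^ (k + 1)) ^ (n + 2))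
        + ∑' n : ℕ, (eᵈ ^ (n + 2) * b * aᵖⁱ * (a + b) ^ n -
            ∑' k : ℕ,
              eᵈ ^ (n + 2) * b * aᵖⁱ * (a + b) ^ (n + 1) * aᵖⁱ * (-a) ^ k * bᵈ ^ (k + 1))) := by
  have hA := ha.isGDrazinInverse
  have hB := hb.isGDrazinInverse
  obtain ⟨p, hpd⟩ : ∃ p, p = a * aᵈ := ⟨_, rfl⟩
  obtain ⟨q, hqd⟩ : ∃ q, q = aᵖⁱ := ⟨_, rfl⟩
  have hq1 : 1 - p = q := by rw [hqd, hpd]; rfl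
  have hp : IsIdempotentElem p := hpd ▸ hA.isIdempotentElem
  have hq : IsIdempotentElem q := hq1 ▸ hp.one_sub
  have hpq : p * q = 0 := by rw [← hq1]; exact hp.mul_one_sub_self
  have hqp : q * p = 0 := by rw [← hq1]; exact hp.one_sub_mul_self
  have haq : Commute a q := by rw [← hq1, hpd]; exact hA.commute_one_sub
  have hap : Commute a p := by rw [hpd]; exact (Commute.refl a).mul_right hA.comm
  have hassoc : ∀ t : A, t * a * aᵈ = t * p := fun t => by rw [hpd, mul_assoc]
  rw [hassoc] at he
  rw [← hqd] at hab
  simp only [hassoc, ← hpd, ← hqd] at hcorner ⊢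
  have hqbp : q * b * p = 0 := by
    have h1 : q * b * a * p = 0 := by rw [hab, mul_assoc, hqp, mul_zero]
    calc q * b * p = q * b * (p * p) := by rw [hp.eq]
      _ = q * b * (p * (a * aᵈ)) := by rw [← hpd]
      _ = q * b * a * p * aᵈ := by rw [← mul_assoc p, ← hap.eq]; simp only [mul_assoc]
      _ = 0 := by rw [h1, zero_mul]
  have hbp : b * p = p * b * p := by
    rw [← sub_eq_zero, ← hqbp, ← hq1, sub_mul, sub_mul, one_mul]
  have hqb : q * b = q * b * q := by
    conv_rhs => rw [← hq1, mul_sub, mul_one, hq1, hqbp, sub_zero]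
  have hxp : (a + b) * p = p * (a + b) * p := by
    rw [mul_add, add_mul, add_mul, ← hbp, ← hap.eq, mul_assoc, hp.eq]
  -- As b is invertible in this sense and triangular, invertibility of its block bp gives that of
  -- qb. The one-sided products pb and bq are triangular with one zero diagonal block, so they
  -- reduce to their other block.
  have hc : GDInvertible (q * b) := by
    have key : GDInvertible (b * p) → GDInvertible (q * b) := fun h =>
      hq1 ▸ hb.one_sub_mul hp hbp h
    rcases hcorner with h | h | h | h | h | h
    · rwa [hqb]
    · exact h
    · rw [hqb, mul_assoc, ← hq1]
      rw [← hq1] at h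
      have h0 : b * (1 - p) * p = 0 := by rw [mul_assoc, hq1, hqp, mul_zero]
      refine h.one_sub_mul hp ?_ ?_
      · rw [h0, mul_assoc, h0, mul_zero]
      · rw [h0]; exact ⟨0, isGDrazinInverse_zero⟩
    · rw [← hbp] at h; exact key h
    · refine key ?_
      rw [hbp]
      refine h.mul_right hp ?_ ?_
      · rw [← mul_assoc p p, hp.eq]
      · rw [hq1, ← mul_assoc, hqp, zero_mul]; exact ⟨0, isGDrazinInverse_zero⟩
    · exact key h
  obtain ⟨d, hd⟩ := hc
  have hu : IsQuasinilpotent (a * q) := by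
    convert hA.quasinilpotent using 1
    rw [← hq1, hpd]; noncomm_ring
  have hcu : Commute (q * b) (a * q) := by
    change q * b * (a * q) = a * q * (q * b)
    rw [← mul_assoc, hab, mul_assoc, hq.eq, ← haq.eq, mul_assoc a q (q * b), ← mul_assoc q q,
      hq.eq, hqb]
    simp only [mul_assoc]
  obtain ⟨hTr, hTinv⟩ := hd.add_quasinilpotent hu hcu
  have hqd' : q * d = d := hd.self_mul_eq (by rw [← mul_assoc, hq.eq])
  have hdq : d * q = d := hd.mul_eq_self hqb.symm
  -- From (qb)q = qb, the element q intertwines b with qb, so dq = qbᵈ and dⁿ⁺¹ = q(bᵈ)ⁿ⁺¹.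
  have hterm : ∀ n : ℕ, (-(a * q)) ^ n * d ^ (n + 1) = q * (-a) ^ n * bᵈ ^ (n + 1) := fun n => by
    have h1 : q * bᵈ ^ (n + 1) = d ^ (n + 1) := by
      have h2 : d * q = q * bᵈ := hd.intertwine hB hqb.symm
      have h3 : q * bᵈ ^ (n + 1) = d ^ (n + 1) * q :=
        ((show SemiconjBy q bᵈ d from h2.symm).pow_right (n + 1)).eq
      rw [h3, pow_succ, mul_assoc, hdq]
    rw [← (haq.neg_left.pow_left n).eq, mul_assoc, h1]
    rcases n with _ | n
    · simp
    · rw [← neg_mul, haq.neg_left.mul_pow, hq.pow_succ_eq, mul_assoc, pow_succ' d, ← mul_assoc q,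
        hqd']
  simp_rw [hterm] at hTr hTinv
  have hT := hTr.summable
  set T := ∑' n : ℕ, q * (-a) ^ n * bᵈ ^ (n + 1) with hTd
  have hw : q * b + a * q = q * (a + b) := by rw [mul_add, haq.eq, add_comm]
  rw [hw] at hTinv
  have hxw : GDInvertible (a + b) ↔ GDInvertible e := by
    rw [he]
    exact GDInvertible.iff_mul_right hp hxp (hq1 ▸ ⟨T, hTinv⟩)
  -- The complementary block of p(a + b) is 0, and its p-block is e by `hxp`.
  have hpx : GDInvertible (p * (a + b)) ↔ GDInvertible (p * (a + b) * p) := by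
    refine GDInvertible.iff_mul_right hp ?_ ?_
    · rw [← mul_assoc p p, hp.eq]
    · rw [hq1, ← mul_assoc, hqp, zero_mul]; exact ⟨0, isGDrazinInverse_zero⟩
  rw [← hxp, ← he] at hpx
  refine ⟨⟨hxw.trans hpx.symm, hpx, by rw [← hxp, ← he]⟩, fun hx => ?_⟩
  have hE := (hxw.1 hx).isGDrazinInverse
  have hep : e * p = e := by rw [he, mul_assoc, hp.eq]
  have hpe : p * e = e := by rw [he, ← mul_assoc, ← hxp]
  have hEp : eᵈ * p = eᵈ := hE.mul_eq_self hep
  have hqw : q * (q * (a + b)) = q * (a + b) := by rw [← mul_assoc, hq.eq]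
  have hwp : q * (a + b) * p = 0 := by rw [mul_assoc, hxp, ← mul_assoc, ← mul_assoc, hqp]; simp
  have hwq : q * (a + b) * q = q * (a + b) := by
    conv_lhs => rw [← hq1, mul_sub, mul_one, hq1, hwp, sub_zero]
  have hqT : q * T = T := hTinv.self_mul_eq hqw
  obtain ⟨hs1, hs2, hinv⟩ := hE.triangular hep hpe hwp (s := p * b * q)
    (by rw [← mul_assoc, hpq, zero_mul]) (by rw [mul_assoc, hqp, mul_zero])
    (by rw [← mul_assoc, ← mul_assoc, hp.eq]) hTinv
  have hsum : e + q * (a + b) + p * b * q = a + b := by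
    have h1 : p * a * q = 0 := by rw [← hap.eq, mul_assoc, hpq, mul_zero]
    calc e + q * (a + b) + p * b * q
        = (a + b) * p + q * (a + b) + (p * a * q + p * b * q) := by rw [h1, zero_add, he]
      _ = (a + b) * p + (1 - p) * (a + b) + p * (a + b) * (1 - p) := by
        rw [hq1, mul_add p, add_mul (p * a)]
      _ = a + b := by rw [sub_mul, mul_sub, one_mul, mul_one, ← hxp]; abel
  rw [hsum] at hinv
  have ht1 : ∀ n : ℕ, eᵖⁱ * e ^ n * p * b * T ^ (n + 2) =
      (1 - e * eᵈ) * e ^ n * (p * b * q) * T ^ (n + 2) := fun n => by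
    rw [pow_succ' T]
    simp only [mul_assoc]
    rw [← mul_assoc q, hqT]
    rfl
  have hfac : ∀ n k : ℕ,
      eᵈ ^ (n + 2) * b * q * (a + b) ^ (n + 1) * q * (-a) ^ k * bᵈ ^ (k + 1) =
      eᵈ ^ (n + 2) * b * q * (a + b) ^ (n + 1) * (q * (-a) ^ k * bᵈ ^ (k + 1)) := fun n k => by
    simp only [mul_assoc]
  have hfac' : ∀ n : ℕ, eᵈ * b * q * (-a) ^ n * bᵈ ^ (n + 1) =
      eᵈ * b * (q * (-a) ^ n * bᵈ ^ (n + 1)) := fun n => by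
    simp only [mul_assoc]
  -- Moving q to the right across (a + b)ᵐ turns it into wᵐ, and eᵈp = eᵈ supplies the p in s; the
  -- difference is then s wⁿ(1 - wT) behind the powers of eᵈ.
  have ht2 : ∀ n : ℕ, eᵈ ^ (n + 2) * b * q * (a + b) ^ n -
        eᵈ ^ (n + 2) * b * q * (a + b) ^ (n + 1) * T =
      eᵈ ^ (n + 2) * (p * b * q) * ((q * (a + b)) ^ n * (1 - q * (a + b) * T)) := fun n => by
    have hqx : ∀ m : ℕ, q * (a + b) ^ m = (q * (a + b)) ^ m * q := fun m =>
      ((show SemiconjBy q (a + b) (q * (a + b)) from hwq.symm).pow_right m).eq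
    have hqw' : Commute q (q * (a + b)) := hqw.trans hwq.symm
    have hEE : ∀ t, eᵈ ^ (n + 2) * (p * t) = eᵈ ^ (n + 2) * t := fun t => by
      rw [pow_succ, ← mul_assoc, mul_assoc _ _ p, hEp]
    simp only [mul_assoc _ q, hqx]
    rw [mul_assoc p b q, mul_assoc _ (p * (b * q)), mul_assoc p (b * q), hEE, mul_assoc b q,
      ← mul_assoc q (_ ^ n), (hqw'.pow_right n).eq, mul_sub, mul_one, mul_assoc _ q (_ * T),
      ← mul_assoc q (_ * _) T, hqw, ← mul_assoc ((q * (a + b)) ^ n) _ T, ← pow_succ, mul_sub, mul_sub]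
    simp only [mul_assoc, hqT]
  have ht3 : eᵈ * (p * b * q) * T = eᵈ * b * T := by
    simp only [mul_assoc]
    rw [← mul_assoc eᵈ p, hEp, hqT]
  simp only [hfac, hfac', hT.tsum_mul_left, ← hTd, ht1, ht2]
  refine ⟨hT, hT.mul_left _, hs1, fun n => hT.mul_left _, hs2, ?_⟩
  rw [hinv.eq_gdInv, ht3]
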